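/- Let $d\ge 1$, let $\mathcal H$ be a $d$-dimensional complex Hilbert space with orthonormal basis $\mathcal B_1=\{|n\rangle : n\in\mathbb Z_d\}$, and let $\mathcal B_2=\{|e_n\rangle : n\in\mathbb Z_d\}$, where $|e_n\rangle=\frac1{\sqrt d}\sum_{m=0}^{d-1}\omega^{mn}|m\rangle$ and $\omega=e^{2\pi i/d}$. For $(a,b)\in\mathbb Z_d\times\mathbb Z_d$ let $U_{ab}=\sum_{n}\omega^{bn}|n\oplus a\rangle\langle n|$ be the Weyl–Heisenberg unitaries. Call a family of orthonormal bases $\mathcal B_i=\{|b_{i,n}\rangle : n\in\mathbb Z_d\}$, $i\in I$ ($I$ finite), mutually unbiased if $|\langle b_{i,m}|b_{j,n}\rangle|^2=1/d$ for all $m,n$ whenever $i\neq j$, and Weyl–Heisenberg generated if for each $i$ the set of states $\rho_{i,n}=|b_{i,n}\rangle\langle b_{i,n}|$ is the orbit $\{U_{ab}\,\rho_{i,0}\,U_{ab}^\dagger\}$. For such a family and probabilities $(p_i)_{i\in I}$, suppose that the signal state $\rho_{i,n}$ is prepared with probability $p_i/d$. A POVM $P=(P(i,n))$ (positive semidefinite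 operators with sum $1$) has error probability $\sum_{(i,n)}\frac{p_i}{d}\sum_{(j,m)\ne(i,n)}\mathrm{Tr}[\rho_{i,n}P(j,m)]$, and is a minimum-error measurement if no POVM with outcomes $(i,n)$ has smaller error probability. It is covariant if $P(i,n)=U_{ab}^\dagger P(i,n')U_{ab}$ whenever $\rho_{i,n'}=U_{ab}\rho_{i,n}U_{ab}^\dagger$. The orthogonal measurement onto $\mathcal B_l$ is $P^{(l)}(i,n)=\delta_{il}\,|b_{l,n}\rangle\langle b_{l,n}|$. 1. $\mathcal B_1,\mathcal B_2$ are mutually unbiased and Weyl–Heisenberg generated. Let the states of $\mathcal B_1$ have prior $p/d$ each and those of $\mathcal B_2$ prior $(1-p)/d$ each, $0\le p\le1$. Then the covariant POVM $P^{(1)}$ is a minimum-error measurement if $p\ge 1/2$, and the covariant POVM $P^{(2)}$ is one if $p<1/2$. For $p\neq1/2$ the minimum-error measurement is unique; for $p=1/2$ every random choice $tP^{(1)}+(1-t)P^{(2)}$, $0\le t\le 1$, is a minimum-error measurement. 2. Let $\{\mathcal B_i\}_{i\in I}$ be any finite family of mutually unbiased, Weyl–Heisenberg generated bases, with priors $p_i/d$,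 $p_i\ge0$, $\sum_i p_i=1$. If $p_l=\max_i p_i$, then the covariant POVM $P^{(l)}$ is a minimum-error measurement, and it is the only one if $p_i<p_l$ for all $i\ne l$. -/

import Mathlib

open scoped Matrix ComplexOrder

namespace MUBDiscrimination

noncomputable section

/-- The `d`-dimensional Hilbert space, with coordinates with respect to the basis
`|n⟩`, `n ∈ ℤ/d`. -/
abbrev Hil (d : ℕ) [NeZero d] : Type := EuclideanSpace ℂ (ZMod d)

/-- The primitive root of unity `ω = exp (2 π i / d)`. -/
def omega (d : ℕ) : ℂ := Complex.exp (2 * Real.pi * Complex.I / d)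

/-- The computational basis vector `|n⟩`. -/
def ket (d : ℕ) [NeZero d] (n : ZMod d) : Hil d := EuclideanSpace.single n 1

/-- The Fourier basis vector `|e_n⟩ = d^{-1/2} ∑ₘ ω^{mn} |m⟩`. -/
def fourierKet (d : ℕ) [NeZero d] (n : ZMod d) : Hil d :=
  ((1 / Real.sqrt d : ℝ) : ℂ) • ∑ m : ZMod d, omega d ^ (m.val * n.val) • ket d m

/-- The rank-one operator `|v⟩⟨v|`. -/
def ketbra {d : ℕ} [NeZero d] (v : Hil d) : Matrix (ZMod d) (ZMod d) ℂ :=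
  Matrix.vecMulVec v.ofLp (star v.ofLp)

/-- A family of mutually unbiased orthonormal bases of the `d`-dimensional space
(an orthonormal family of `d` vectors is a basis). -/
def IsMUB {d : ℕ} [NeZero d] {I : Type*} (B : I → ZMod d → Hil d) : Prop :=
  (∀ i, Orthonormal ℂ (B i)) ∧
    ∀ i j, i ≠ j → ∀ m n, ‖inner ℂ (B i m) (B j n)‖ ^ 2 = 1 / (d : ℝ)

/-- The Weyl-Heisenberg unitaries `U_{ab} = ∑ₙ ω^{bn} |n + a⟩⟨n|`, `(a, b) ∈ ℤ/d × ℤ/d`. -/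
def weyl (d : ℕ) [NeZero d] (g : ZMod d × ZMod d) : Matrix (ZMod d) (ZMod d) ℂ :=
  fun m n => if m = n + g.1 then omega d ^ (g.2.val * n.val) else 0

/-- Every basis of the family is generated by the Weyl-Heisenberg representation: its set of
pure states is the orbit of the initial state `|B_{i,0}⟩⟨B_{i,0}|` under `ρ ↦ U_g ρ U_g†`. -/
def WeylGenerated {d : ℕ} [NeZero d] {I : Type*} (B : I → ZMod d → Hil d) : Prop :=
  ∀ i, Set.range (fun n => ketbra (B i n)) =
    Set.range (fun g => weyl d g * ketbra (B i 0) * (weyl d g)ᴴ)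

/-- A POVM with finite outcome space `X`, given by its values on points. -/
def IsPOVM {d : ℕ} [NeZero d] {X : Type*} [Fintype X]
    (P : X → Matrix (ZMod d) (ZMod d) ℂ) : Prop :=
  (∀ x, (P x).PosSemidef) ∧ ∑ x, P x = 1

/-- The error probability when the signal state `ρ x` is prepared with probability `w x` and
the outcome `y` of the measurement `P` is taken as the guess of the signal:
`∑ₓ w x ∑_{y ≠ x} Tr[ρ x P y]`. -/
def errorProb {d : ℕ} [NeZero d] {X : Type*} [Fintype X] [DecidableEq X]
    (w : X → ℝ) (ρ P : X → Matrix (ZMod d) (ZMod d) ℂ) : ℝ :=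
  ∑ x, w x * ∑ y ∈ Finset.univ.erase x, (Matrix.trace (ρ x * P y)).re

/-- `P` is a POVM of minimum error probability among all POVMs with outcome space `X`. -/
def IsMinError {d : ℕ} [NeZero d] {X : Type*} [Fintype X] [DecidableEq X]
    (w : X → ℝ) (ρ P : X → Matrix (ZMod d) (ZMod d) ℂ) : Prop :=
  IsPOVM P ∧ ∀ Q : X → Matrix (ZMod d) (ZMod d) ℂ, IsPOVM Q →
    errorProb w ρ P ≤ errorProb w ρ Q

/-- The signal states: `(i, n)` labels the `n`-th vector state of the `i`-th basis. -/
def signal {d : ℕ} [NeZero d] {I : Type*} (B : I → ZMod d → Hil d) (x : I × ZMod d) :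
    Matrix (ZMod d) (ZMod d) ℂ :=
  ketbra (B x.1 x.2)

/-- The prior probabilities `p_i / d` of the signal states. -/
def prior (d : ℕ) {I : Type*} (p : I → ℝ) (x : I × ZMod d) : ℝ := p x.1 / d

/-- Covariance under the Weyl-Heisenberg representation: `P(x) = U_g† P(g x) U_g`, the group
acting on the labels `x = (i, n)` of each basis as it acts on the corresponding states, that is,
`g (i, n) = (i, n')` when `ρ_{i,n'} = U_g ρ_{i,n} U_g†`. -/
def IsWeylCovariant {d : ℕ} [NeZero d] {I : Type*} (B : I → ZMod d → Hil d)
    (P : I × ZMod d → Matrix (ZMod d) (ZMod d) ℂ) : Prop :=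
  ∀ (g : ZMod d × ZMod d) (i : I) (n n' : ZMod d),
    signal B (i, n') = weyl d g * signal B (i, n) * (weyl d g)ᴴ →
      P (i, n) = (weyl d g)ᴴ * P (i, n') * weyl d g

/-- The orthogonal measurement onto the basis `B l`: `P (i, n) = δ_{i l} |B_{l,n}⟩⟨B_{l,n}|`. -/
def basisMeas {d : ℕ} [NeZero d] {I : Type*} [DecidableEq I] (B : I → ZMod d → Hil d) (l : I)
    (x : I × ZMod d) : Matrix (ZMod d) (ZMod d) ℂ :=
  if x.1 = l then ketbra (B l x.2) else 0

/-- The computational basis (index `0`) and the Fourier basis (index `1`). -/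
def fourierPair (d : ℕ) [NeZero d] : Fin 2 → ZMod d → Hil d :=
  ![ket d, fourierKet d]

end

end MUBDiscrimination

namespace MUBDiscrimination

variable {d : ℕ} [NeZero d]

/-! Since the effects sum to `1` and each signal has trace one, the error is `∑ pᵢ` minus the
success probability `∑ₓ (pₓ/d) Tr(ρₓ Pₓ)`. From `ρₓ ≤ 1` and `pₓ ≤ p_l` the latter is at most
`(p_l/d) ∑ₓ Tr Pₓ = p_l`, which measuring in `B l` attains. `errorProb_eq` records the loss in these
two inequalities as an exact sum. For a strictly largest `p_l`, an optimal POVM has zero loss in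
every term: effects for the other bases vanish and each `P(l,n)` is supported on the line of `B l
n`. Completeness and orthogonality then determine it (`eq_basisMeas_of_isMinError`). At `p = 1/2`
both measurements are optimal, and the error is affine in the POVM. -/

/-! ### Rank-one projectors and traces against positive operators. -/

theorem isHermitian_ketbra (v : Hil d) : (ketbra v)ᴴ = ketbra v := by
  simp [ketbra, Matrix.conjTranspose_vecMulVec]

theorem posSemidef_ketbra (v : Hil d) : (ketbra v).PosSemidef :=
  Matrix.posSemidef_vecMulVec_self_star _

theorem ketbra_mul_ketbra (v w : Hil d) :
    ketbra v * ketbra w = inner ℂ v w • Matrix.vecMulVec v.ofLp (star w.ofLp) := by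
  rw [ketbra, ketbra, Matrix.vecMulVec_mul_vecMulVec, Matrix.vecMulVec_smul,
    EuclideanSpace.inner_eq_star_dotProduct, dotProduct_comm]

theorem ketbra_mul_self {v : Hil d} (hv : ‖v‖ = 1) : ketbra v * ketbra v = ketbra v := by
  rw [ketbra_mul_ketbra, inner_self_eq_norm_sq_to_K, hv]
  simp [ketbra]

theorem trace_ketbra {v : Hil d} (hv : ‖v‖ = 1) : (ketbra v).trace = 1 := by
  rw [ketbra, Matrix.trace_vecMulVec, ← EuclideanSpace.inner_eq_star_dotProduct,
    inner_self_eq_norm_sq_to_K, hv]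
  simp

theorem ketbra_smul {c : ℂ} (hc : ‖c‖ = 1) (v : Hil d) : ketbra (c • v) = ketbra v := by
  have h : c * (starRingEnd ℂ) c = 1 := by rw [Complex.mul_conj']; simp [hc]
  ext i j
  simp only [ketbra, Matrix.vecMulVec_apply, PiLp.smul_apply, Pi.star_apply, smul_eq_mul,
    star_mul', RCLike.star_def]
  linear_combination (v i * (starRingEnd ℂ) (v j)) * h

theorem mul_ketbra_mul_conjTranspose (U : Matrix (ZMod d) (ZMod d) ℂ) (v : Hil d) :
    U * ketbra v * Uᴴ = ketbra (WithLp.toLp 2 (U *ᵥ v.ofLp)) := by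
  rw [ketbra, ketbra, Matrix.mul_vecMulVec, Matrix.vecMulVec_mul, Matrix.star_mulVec]

theorem sum_ketbra {b : ZMod d → Hil d} (hb : Orthonormal ℂ b) : ∑ n, ketbra (b n) = 1 := by
  let V : Matrix (ZMod d) (ZMod d) ℂ := fun m n => b n m
  have h : Vᴴ * V = 1 := by
    ext i j
    rw [Matrix.mul_apply, Matrix.one_apply, ← orthonormal_iff_ite.mp hb i j,
      EuclideanSpace.inner_eq_star_dotProduct, dotProduct]
    exact Finset.sum_congr rfl fun _ _ => mul_comm _ _
  -- `V` is square, so orthonormal columns give `V * Vᴴ = 1`, which is the resolution of the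
  -- identity.
  rw [← mul_eq_one_comm.mp h]
  ext i j
  rw [Matrix.sum_apply, Matrix.mul_apply]
  rfl

/-- For an orthogonal projector `A` and a positive semidefinite `P`, `Tr (A P) ≥ 0`. -/
theorem trace_projector_mul_nonneg {A P : Matrix (ZMod d) (ZMod d) ℂ} (hA : Aᴴ = A)
    (hAA : A * A = A) (hP : P.PosSemidef) : 0 ≤ (A * P).trace := by
  have h : (A * P).trace = (A * P * Aᴴ).trace := by
    rw [Matrix.trace_mul_comm (A * P), hA, ← mul_assoc, hAA]
  rw [h]
  exact (hP.mul_mul_conjTranspose_same A).trace_nonneg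

/-- If `A` is an orthogonal projector and `P` is positive semidefinite, then `Tr (A P) = 0` only
if `A P = 0`. -/
theorem projector_mul_eq_zero {A P : Matrix (ZMod d) (ZMod d) ℂ} (hA : Aᴴ = A)
    (hAA : A * A = A) (hP : P.PosSemidef) (h : (A * P).trace = 0) : A * P = 0 := by
  obtain ⟨C, rfl⟩ : ∃ C : Matrix (ZMod d) (ZMod d) ℂ, P = Cᴴ * C := by
    open scoped MatrixOrder in
    exact CStarAlgebra.nonneg_iff_eq_star_mul_self.mp hP.nonneg
  -- With `P = Cᴴ * C`, the trace is the squared Hilbert–Schmidt norm of `A * Cᴴ`.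
  have h0 : ((A * Cᴴ) * (A * Cᴴ)ᴴ).trace = 0 := by
    rw [← h, Matrix.conjTranspose_mul, Matrix.conjTranspose_conjTranspose, hA,
      ← mul_assoc, Matrix.trace_mul_comm, ← mul_assoc, ← mul_assoc, hAA, mul_assoc]
  rw [← mul_assoc, Matrix.trace_mul_conjTranspose_self_eq_zero_iff.mp h0, zero_mul]

theorem one_sub_ketbra_conjTranspose (v : Hil d) : (1 - ketbra v)ᴴ = 1 - ketbra v := by
  rw [Matrix.conjTranspose_sub, Matrix.conjTranspose_one, isHermitian_ketbra]

theorem one_sub_ketbra_mul_self {v : Hil d} (hv : ‖v‖ = 1) :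
    (1 - ketbra v) * (1 - ketbra v) = 1 - ketbra v := by
  rw [mul_sub, sub_mul, sub_mul, ketbra_mul_self hv]
  simp

/-! ### The error bound, its equality case, and convexity. -/

section

variable {I : Type*} [Fintype I]

theorem trace_re_nonneg {P : Matrix (ZMod d) (ZMod d) ℂ} (hP : P.PosSemidef) :
    0 ≤ P.trace.re :=
  (Complex.nonneg_iff.mp hP.trace_nonneg).1

theorem trace_one_sub_ketbra_mul_re_nonneg {v : Hil d} (hv : ‖v‖ = 1)
    {P : Matrix (ZMod d) (ZMod d) ℂ} (hP : P.PosSemidef) :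
    0 ≤ ((1 - ketbra v) * P).trace.re :=
  (Complex.nonneg_iff.mp (trace_projector_mul_nonneg (one_sub_ketbra_conjTranspose v)
    (one_sub_ketbra_mul_self hv) hP)).1

/-- The two terms are the two sources of loss: weight placed on a basis of smaller prior, and the
part of `P x` orthogonal to the guessed state. -/
theorem excess_nonneg {B : I → ZMod d → Hil d} (hB : ∀ i, Orthonormal ℂ (B i)) {p : I → ℝ}
    (hp : ∀ i, 0 ≤ p i) {l : I} (hl : ∀ i, p i ≤ p l)
    {P : I × ZMod d → Matrix (ZMod d) (ZMod d) ℂ} (hP : IsPOVM P) (x : I × ZMod d) :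
    0 ≤ (p l - p x.1) / d * (P x).trace.re +
        p x.1 / d * ((1 - signal B x) * P x).trace.re :=
  add_nonneg
    (mul_nonneg (div_nonneg (sub_nonneg.mpr (hl _)) d.cast_nonneg) (trace_re_nonneg (hP.1 x)))
    (mul_nonneg (div_nonneg (hp _) d.cast_nonneg)
      (trace_one_sub_ketbra_mul_re_nonneg ((hB _).norm_eq_one _) (hP.1 x)))

variable [DecidableEq I]

theorem isPOVM_basisMeas {B : I → ZMod d → Hil d} {l : I} (hB : Orthonormal ℂ (B l)) :
    IsPOVM (basisMeas B l) := by
  refine ⟨fun x => ?_, ?_⟩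
  · unfold basisMeas
    split_ifs
    exacts [posSemidef_ketbra _, Matrix.PosSemidef.zero]
  · rw [Fintype.sum_prod_type, Finset.sum_eq_single l]
    · simpa [basisMeas] using sum_ketbra hB
    · intro i _ hi
      simp [basisMeas, hi]
    · simp

/-- The error probability exceeds `∑ᵢ pᵢ - p_l` by a sum which is termwise nonnegative when `p_l`
is maximal. -/
theorem errorProb_eq {B : I → ZMod d → Hil d} (hB : ∀ i, Orthonormal ℂ (B i)) (p : I → ℝ) (l : I)
    {P : I × ZMod d → Matrix (ZMod d) (ZMod d) ℂ} (hP : IsPOVM P) :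
    errorProb (prior d p) (signal B) P = ∑ i, p i - p l +
      ∑ x : I × ZMod d, ((p l - p x.1) / d * (P x).trace.re +
        p x.1 / d * ((1 - signal B x) * P x).trace.re) := by
  have hd : (d : ℝ) ≠ 0 := NeZero.ne _
  have h1 (x : I × ZMod d) :
      ∑ y ∈ Finset.univ.erase x, ((signal B x) * P y).trace.re =
        1 - ((signal B x) * P x).trace.re := by
    rw [eq_sub_iff_add_eq, Finset.sum_erase_add _ _ (Finset.mem_univ x), ← Complex.re_sum,
      ← Matrix.trace_sum, ← Finset.mul_sum, hP.2, mul_one, signal,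
      trace_ketbra ((hB x.1).norm_eq_one _), Complex.one_re]
  have h2 : ∑ x, (P x).trace.re = d := by
    rw [← Complex.re_sum, ← Matrix.trace_sum, hP.2, Matrix.trace_one, ZMod.card, Complex.natCast_re]
  have h3 : ∑ x : I × ZMod d, p x.1 / d = ∑ i, p i := by
    rw [Fintype.sum_prod_type]
    refine Finset.sum_congr rfl fun i _ => ?_
    simp only [Finset.sum_const, Finset.card_univ, ZMod.card, nsmul_eq_mul, mul_div_cancel₀ _ hd]
  have h4 (x : I × ZMod d) : (p l - p x.1) / d * (P x).trace.re +
        p x.1 / d * ((1 - signal B x) * P x).trace.re =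
      p l / d * (P x).trace.re - p x.1 / d * (signal B x * P x).trace.re := by
    rw [sub_mul, one_mul, Matrix.trace_sub, Complex.sub_re]
    ring
  simp only [h4, errorProb, h1, prior, mul_sub, mul_one, Finset.sum_sub_distrib, h3]
  rw [← Finset.mul_sum, h2, div_mul_cancel₀ _ hd]
  ring

theorem errorProb_basisMeas {B : I → ZMod d → Hil d} (hB : ∀ i, Orthonormal ℂ (B i)) (p : I → ℝ)
    (l : I) : errorProb (prior d p) (signal B) (basisMeas B l) = ∑ i, p i - p l := by
  rw [errorProb_eq hB p l (isPOVM_basisMeas (hB l)), add_eq_left]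
  refine Finset.sum_eq_zero ?_
  rintro ⟨i, n⟩ -
  by_cases h : i = l
  · subst h
    simp [basisMeas, signal, sub_mul, ketbra_mul_self ((hB i).norm_eq_one n)]
  · simp [basisMeas, h]

theorem isMinError_basisMeas {B : I → ZMod d → Hil d} (hB : ∀ i, Orthonormal ℂ (B i)) {p : I → ℝ}
    (hp : ∀ i, 0 ≤ p i) {l : I} (hl : ∀ i, p i ≤ p l) :
    IsMinError (prior d p) (signal B) (basisMeas B l) := by
  refine ⟨isPOVM_basisMeas (hB l), fun Q hQ => ?_⟩
  rw [errorProb_basisMeas hB, errorProb_eq hB p l hQ]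
  exact le_add_of_nonneg_right (Finset.sum_nonneg fun x _ => excess_nonneg hB hp hl hQ x)

theorem eq_zero_of_trace_re_eq_zero {P : Matrix (ZMod d) (ZMod d) ℂ} (hP : P.PosSemidef)
    (h : P.trace.re = 0) : P = 0 :=
  hP.trace_eq_zero_iff.mp (Complex.ext h (Complex.nonneg_iff.mp hP.trace_nonneg).2.symm)

theorem ketbra_mul_eq_self_of_trace {v : Hil d} (hv : ‖v‖ = 1)
    {P : Matrix (ZMod d) (ZMod d) ℂ} (hP : P.PosSemidef)
    (h : ((1 - ketbra v) * P).trace.re = 0) : ketbra v * P = P := by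
  have hA := one_sub_ketbra_conjTranspose v
  have hAA := one_sub_ketbra_mul_self hv
  have h0 := projector_mul_eq_zero hA hAA hP
    (Complex.ext h (Complex.nonneg_iff.mp (trace_projector_mul_nonneg hA hAA hP)).2.symm)
  rw [sub_mul, one_mul, sub_eq_zero] at h0
  exact h0.symm

theorem eq_basisMeas_of_isMinError {B : I → ZMod d → Hil d} (hB : ∀ i, Orthonormal ℂ (B i))
    {p : I → ℝ} (hp : ∀ i, 0 ≤ p i) (hsum : ∑ i, p i = 1) {l : I} (hl : ∀ i, i ≠ l → p i < p l)
    {Q : I × ZMod d → Matrix (ZMod d) (ZMod d) ℂ}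
    (hQ : IsMinError (prior d p) (signal B) Q) : Q = basisMeas B l := by
  have hd : (0 : ℝ) < d := Nat.cast_pos.mpr (NeZero.pos d)
  have hle (i) : p i ≤ p l := by
    rcases eq_or_ne i l with rfl | h
    exacts [le_rfl, (hl i h).le]
  have hpl : 0 < p l := by
    by_contra! h
    have h0 (i) : p i = 0 := le_antisymm ((hle i).trans h) (hp i)
    simp [h0] at hsum
  -- Comparison with `basisMeas B l`, whose excess is zero, forces the total excess of `Q` to
  -- vanish, hence each term.
  have hzero :=
    (Finset.sum_eq_zero_iff_of_nonneg (s := Finset.univ) fun x _ => excess_nonneg hB hp hle hQ.1 x).mp <| by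
      refine le_antisymm ?_ (Finset.sum_nonneg fun x _ => excess_nonneg hB hp hle hQ.1 x)
      have h := hQ.2 _ (isPOVM_basisMeas (hB l))
      rw [errorProb_basisMeas hB, errorProb_eq hB p l hQ.1] at h
      linarith
  have hoff (i n) (hi : i ≠ l) : Q (i, n) = 0 := by
    have h := hzero (i, n) (Finset.mem_univ _)
    refine eq_zero_of_trace_re_eq_zero (hQ.1.1 _) ?_
    have h1 := trace_re_nonneg (hQ.1.1 (i, n))
    have h2 := mul_nonneg (div_nonneg (hp i) hd.le)
      (trace_one_sub_ketbra_mul_re_nonneg ((hB i).norm_eq_one n) (hQ.1.1 (i, n)))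
    have h3 : 0 < (p l - p i) / d := div_pos (sub_pos.mpr (hl i hi)) hd
    have h4 := mul_nonneg h3.le h1
    have h5 : (p l - p i) / d * (Q (i, n)).trace.re = 0 := by
      simp only [signal] at h
      linarith
    exact (mul_eq_zero.mp h5).resolve_left h3.ne'
  have hdiag (n) : ketbra (B l n) * Q (l, n) = Q (l, n) := by
    refine ketbra_mul_eq_self_of_trace ((hB l).norm_eq_one n) (hQ.1.1 _) ?_
    have h := hzero (l, n) (Finset.mem_univ _)
    rw [sub_self, zero_div, zero_mul, zero_add] at h
    exact (mul_eq_zero.mp h).resolve_left (div_pos hpl hd).ne'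
  have hone : ∑ m, Q (l, m) = 1 := by
    rw [← hQ.1.2, Fintype.sum_prod_type]
    exact (Finset.sum_eq_single l
      (fun i _ hi => Finset.sum_eq_zero fun n _ => hoff i n hi) (by simp)).symm
  funext ⟨i, n⟩
  by_cases hi : i = l
  · subst hi
    -- Each `Q (i, m)` absorbs its own projector on the left, so orthogonality kills the terms `m ≠
    -- n`; completeness evaluates the same sum as `ketbra (B i n)`.
    have h : ∑ m, ketbra (B i n) * Q (i, m) = Q (i, n) := by
      rw [Finset.sum_eq_single n (fun m _ hm => ?_) (by simp), hdiag]
      rw [← hdiag m, ← mul_assoc, ketbra_mul_ketbra, (hB i).inner_eq_zero hm.symm, zero_smul,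
        zero_mul]
    rw [← Finset.mul_sum, hone, mul_one] at h
    simp [basisMeas, h]
  · simp [basisMeas, hi, hoff i n hi]

theorem errorProb_convexComb (w : I → ℝ) (ρ P Q : I → Matrix (ZMod d) (ZMod d) ℂ) (t : ℝ) :
    errorProb w ρ (fun x => t • P x + (1 - t) • Q x) =
      t * errorProb w ρ P + (1 - t) * errorProb w ρ Q := by
  simp only [errorProb, mul_add, Matrix.trace_add, Complex.add_re, Finset.sum_add_distrib,
    Matrix.mul_smul, Matrix.trace_smul, Complex.smul_re, smul_eq_mul, ← Finset.mul_sum]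
  rw [Finset.mul_sum, Finset.mul_sum]
  congr 1 <;> exact Finset.sum_congr rfl fun _ _ => by ring

theorem IsMinError.convexComb {w : I → ℝ} {ρ P Q : I → Matrix (ZMod d) (ZMod d) ℂ}
    (hP : IsMinError w ρ P) (hQ : IsMinError w ρ Q) {t : ℝ} (h0 : 0 ≤ t) (h1 : t ≤ 1) :
    IsMinError w ρ (fun x => t • P x + (1 - t) • Q x) := by
  refine ⟨⟨fun x => ((hP.1.1 x).smul h0).add ((hQ.1.1 x).smul (sub_nonneg.mpr h1)), ?_⟩,
    fun R hR => ?_⟩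
  · rw [Finset.sum_add_distrib, ← Finset.smul_sum, ← Finset.smul_sum, hP.1.2, hQ.1.2, ← add_smul,
      add_sub_cancel, one_smul]
  · rw [errorProb_convexComb]
    nlinarith [mul_le_mul_of_nonneg_left (hP.2 R hR) h0,
      mul_le_mul_of_nonneg_left (hQ.2 R hR) (sub_nonneg.mpr h1)]

end

/-! ### The Fourier pair and the Weyl–Heisenberg action. -/

/-- Rewriting powers of `omega d` as an additive character moves exponents from `ℕ` to `ZMod d`,
where ring identities apply without reduction modulo `d`. -/
theorem omega_pow (k : ℕ) : omega d ^ k = ZMod.stdAddChar (k : ZMod d) := by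
  have h := ZMod.stdAddChar_coe (N := d) (k : ℤ)
  rw [Int.cast_natCast] at h
  rw [h, omega, ← Complex.exp_nat_mul]
  congr 1
  push_cast
  ring

theorem omega_pow_val_mul_val (m n : ZMod d) :
    omega d ^ (m.val * n.val) = ZMod.stdAddChar (m * n) := by
  rw [omega_pow, Nat.cast_mul, ZMod.natCast_zmod_val, ZMod.natCast_zmod_val]

theorem star_stdAddChar_mul_self (x : ZMod d) :
    star (ZMod.stdAddChar x : ℂ) * ZMod.stdAddChar x = 1 := by
  rw [RCLike.star_def, ← AddChar.map_neg_eq_conj, ← AddChar.map_add_eq_mul, neg_add_cancel,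
    AddChar.map_zero_eq_one]

theorem fourierKet_apply (n m : ZMod d) :
    fourierKet d n m = ((1 / Real.sqrt d : ℝ) : ℂ) * ZMod.stdAddChar (m * n) := by
  simp [fourierKet, ket, omega_pow_val_mul_val, Finset.sum_apply, Pi.single_apply]

theorem weyl_conjTranspose_mul_self (g : ZMod d × ZMod d) : (weyl d g)ᴴ * weyl d g = 1 := by
  ext i j
  rw [Matrix.mul_apply, Finset.sum_eq_single (j + g.1) (fun m _ hm => by simp [weyl, hm]) (by simp),
    Matrix.one_apply, Matrix.conjTranspose_apply]
  by_cases h : i = j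
  · subst h
    simpa [weyl, omega_pow_val_mul_val] using star_stdAddChar_mul_self (g.2 * i)
  · simp [weyl, h, Ne.symm h]

theorem weyl_mulVec (g : ZMod d × ZMod d) (v : ZMod d → ℂ) (m : ZMod d) :
    (weyl d g *ᵥ v) m = ZMod.stdAddChar (g.2 * (m - g.1)) * v (m - g.1) := by
  rw [Matrix.mulVec, dotProduct, Finset.sum_eq_single (m - g.1) (fun n _ hn => ?_) (by simp)]
  · simp [weyl, omega_pow_val_mul_val]
  · have : m ≠ n + g.1 := fun h => hn (by simp [h])
    simp [weyl, this]

theorem weyl_mulVec_ket_zero (g : ZMod d × ZMod d) :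
    WithLp.toLp 2 (weyl d g *ᵥ (ket d 0).ofLp) = ket d g.1 := by
  ext m
  by_cases h : m = g.1
  · subst h; simp [weyl_mulVec, ket]
  · simp [weyl_mulVec, ket, h, sub_eq_zero]

/-- In the Fourier basis the roles are exchanged: modulation by `g.2` moves the label and
translation by `g.1` gives only a phase, invisible to `ketbra`. -/
theorem weyl_mulVec_fourierKet_zero (g : ZMod d × ZMod d) :
    WithLp.toLp 2 (weyl d g *ᵥ (fourierKet d 0).ofLp) =
      (ZMod.stdAddChar (-(g.1 * g.2)) : ℂ) • fourierKet d g.2 := by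
  ext m
  have h : (ZMod.stdAddChar (g.2 * (m - g.1)) : ℂ) =
      ZMod.stdAddChar (-(g.1 * g.2)) * ZMod.stdAddChar (m * g.2) := by
    rw [← AddChar.map_add_eq_mul]
    congr 1
    ring
  rw [PiLp.smul_apply, PiLp.toLp_apply, weyl_mulVec, fourierKet_apply, fourierKet_apply, mul_zero,
    AddChar.map_zero_eq_one, smul_eq_mul, h]
  ring

theorem orthonormal_ket : Orthonormal ℂ (ket d) := by
  rw [orthonormal_iff_ite]
  intro i j
  simp [ket, EuclideanSpace.inner_single_left]

theorem orthonormal_fourierKet : Orthonormal ℂ (fourierKet d) := by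
  rw [orthonormal_iff_ite]
  intro i j
  have hs : ((1 / Real.sqrt d : ℝ) : ℂ) * ((1 / Real.sqrt d : ℝ) : ℂ) * d = 1 := by
    have hd : (d : ℝ) ≠ 0 := NeZero.ne _
    have : 1 / Real.sqrt d * (1 / Real.sqrt d) * (d : ℝ) = 1 := by
      rw [div_mul_div_comm, Real.mul_self_sqrt d.cast_nonneg, one_mul, one_div_mul_cancel hd]
    exact_mod_cast this
  have h (m : ZMod d) : fourierKet d j m * star (fourierKet d i m) =
      ((1 / Real.sqrt d : ℝ) : ℂ) * ((1 / Real.sqrt d : ℝ) : ℂ) *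
        ZMod.stdAddChar (m * (j - i)) := by
    rw [fourierKet_apply, fourierKet_apply, star_mul', RCLike.star_def, Complex.conj_ofReal,
      ← AddChar.map_neg_eq_conj, mul_sub, sub_eq_add_neg,
      AddChar.map_add_eq_mul]
    ring
  rw [EuclideanSpace.inner_eq_star_dotProduct, dotProduct]
  simp only [Pi.star_apply, h]
  -- By primitivity of the character, the sum over `m` is `d` if `j = i` and zero otherwise.
  rw [← Finset.mul_sum, AddChar.sum_mulShift _ (ZMod.isPrimitive_stdAddChar d), ZMod.card]
  by_cases hij : i = j
  · subst hij; simpa using hs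
  · simp [hij, sub_eq_zero, Ne.symm hij]

theorem norm_fourierKet_apply_sq (n m : ZMod d) : ‖fourierKet d n m‖ ^ 2 = 1 / (d : ℝ) := by
  rw [fourierKet_apply, norm_mul, AddChar.norm_apply, mul_one, Complex.norm_real, Real.norm_eq_abs,
    sq_abs, div_pow, one_pow, Real.sq_sqrt d.cast_nonneg]

theorem norm_inner_ket_fourierKet_sq (m n : ZMod d) :
    ‖inner ℂ (ket d m) (fourierKet d n)‖ ^ 2 = 1 / (d : ℝ) := by
  rw [← norm_fourierKet_apply_sq n m]
  simp [ket, EuclideanSpace.inner_single_left]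

theorem isMUB_fourierPair : IsMUB (fourierPair d) := by
  refine ⟨Fin.forall_fin_two.mpr ⟨orthonormal_ket, orthonormal_fourierKet⟩, ?_⟩
  simp only [Fin.forall_fin_two]
  refine ⟨⟨fun h => absurd rfl h, fun _ m n => norm_inner_ket_fourierKet_sq m n⟩,
    fun _ m n => ?_, fun h => absurd rfl h⟩
  rw [norm_inner_symm]
  exact norm_inner_ket_fourierKet_sq n m

theorem weylGenerated_fourierPair : WeylGenerated (fourierPair d) := by
  refine Fin.forall_fin_two.mpr ⟨?_, ?_⟩
  · have h (g : ZMod d × ZMod d) :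
        weyl d g * ketbra (fourierPair d 0 0) * (weyl d g)ᴴ = ketbra (fourierPair d 0 g.1) := by
      rw [mul_ketbra_mul_conjTranspose]
      exact congrArg ketbra (weyl_mulVec_ket_zero g)
    simp only [h]
    -- The conjugated state depends on `g.1` alone, which takes every value, so the orbit is the
    -- whole basis.
    exact (Prod.fst_surjective.range_comp fun n => ketbra (fourierPair d 0 n)).symm
  · have h (g : ZMod d × ZMod d) :
        weyl d g * ketbra (fourierPair d 1 0) * (weyl d g)ᴴ = ketbra (fourierPair d 1 g.2) := by
      rw [mul_ketbra_mul_conjTranspose]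
      exact (congrArg ketbra (weyl_mulVec_fourierKet_zero g)).trans
        (ketbra_smul (AddChar.norm_apply _ _) _)
    simp only [h]
    exact (Prod.snd_surjective.range_comp fun n => ketbra (fourierPair d 1 n)).symm

/-- On block `l` the effects are the signal states themselves, so covariance amounts to undoing a
unitary conjugation; elsewhere both sides are zero. -/
theorem isWeylCovariant_basisMeas {I : Type*} [DecidableEq I] (B : I → ZMod d → Hil d) (l : I) :
    IsWeylCovariant B (basisMeas B l) := by
  intro g i n n' h
  by_cases hi : i = l
  · subst hi
    have hU := weyl_conjTranspose_mul_self g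
    simp only [signal] at h
    simp only [basisMeas, if_true]
    rw [h, mul_assoc, mul_assoc, hU, mul_one, ← mul_assoc, hU, one_mul]
  · simp [basisMeas, hi]

end MUBDiscrimination


open MUBDiscrimination in
theorem mainTheorem7 (d : ℕ) [NeZero d] :
    -- the two Fourier-related bases are mutually unbiased and Weyl-Heisenberg generated
    (IsMUB (fourierPair d) ∧ WeylGenerated (fourierPair d)) ∧
    -- discrimination of the two bases with priors `p / d` and `(1 - p) / d`
    (∀ p : ℝ, 0 ≤ p → p ≤ 1 →
      (1 / 2 ≤ p →
        IsMinError (prior d ![p, 1 - p]) (signal (fourierPair d)) (basisMeas (fourierPair d) 0) ∧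
        IsWeylCovariant (fourierPair d) (basisMeas (fourierPair d) 0)) ∧
      (p < 1 / 2 →
        IsMinError (prior d ![p, 1 - p]) (signal (fourierPair d)) (basisMeas (fourierPair d) 1) ∧
        IsWeylCovariant (fourierPair d) (basisMeas (fourierPair d) 1)) ∧
      -- uniqueness of the optimal measurement away from `p = 1 / 2`
      (1 / 2 < p → ∀ Q : Fin 2 × ZMod d → Matrix (ZMod d) (ZMod d) ℂ,
        IsMinError (prior d ![p, 1 - p]) (signal (fourierPair d)) Q →
          Q = basisMeas (fourierPair d) 0) ∧
      (p < 1 / 2 → ∀ Q : Fin 2 × ZMod d → Matrix (ZMod d) (ZMod d) ℂ,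
        IsMinError (prior d ![p, 1 - p]) (signal (fourierPair d)) Q →
          Q = basisMeas (fourierPair d) 1) ∧
      -- for `p = 1 / 2` every random choice between the two measurements is optimal
      (p = 1 / 2 → ∀ t : ℝ, 0 ≤ t → t ≤ 1 →
        IsMinError (prior d ![p, 1 - p]) (signal (fourierPair d))
          (fun x => t • basisMeas (fourierPair d) 0 x +
            (1 - t) • basisMeas (fourierPair d) 1 x))) ∧
    -- discrimination of several mutually unbiased bases
    (∀ (I : Type*) [Fintype I] [DecidableEq I] (B : I → ZMod d → Hil d),
      IsMUB B → WeylGenerated B →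
      ∀ p : I → ℝ, (∀ i, 0 ≤ p i) → ∑ i, p i = 1 →
      ∀ l : I, (∀ i, p i ≤ p l) →
        IsMinError (prior d p) (signal B) (basisMeas B l) ∧
        IsWeylCovariant B (basisMeas B l) ∧
        ((∀ i, i ≠ l → p i < p l) →
          ∀ Q : I × ZMod d → Matrix (ZMod d) (ZMod d) ℂ,
            IsMinError (prior d p) (signal B) Q → Q = basisMeas B l)) := by 
  have hB := (isMUB_fourierPair (d := d)).1
  have h0 {p : ℝ} (hp : 0 ≤ p) (hp1 : p ≤ 1) (i : Fin 2) : 0 ≤ ![p, 1 - p] i := by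
    fin_cases i
    exacts [hp, sub_nonneg.mpr hp1]
  have hsum (p : ℝ) : ∑ i, ![p, 1 - p] i = 1 := by simp
  have hfst {p : ℝ} (hp : 1 / 2 ≤ p) (i : Fin 2) : ![p, 1 - p] i ≤ ![p, 1 - p] 0 := by
    fin_cases i
    exacts [le_rfl, show 1 - p ≤ p by linarith]
  have hsnd {p : ℝ} (hp : p ≤ 1 / 2) (i : Fin 2) : ![p, 1 - p] i ≤ ![p, 1 - p] 1 := by
    fin_cases i
    exacts [show p ≤ 1 - p by linarith, le_rfl]
  refine ⟨⟨isMUB_fourierPair, weylGenerated_fourierPair⟩, fun p hp hp1 => ⟨fun h => ?_, fun h => ?_,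
    fun h Q hQ => ?_, fun h Q hQ => ?_, fun h t ht ht1 => ?_⟩, fun I _ _ B hB _ p hp hsum l hl => ?_⟩
  · exact ⟨isMinError_basisMeas hB (h0 hp hp1) (hfst h), isWeylCovariant_basisMeas _ _⟩
  · exact ⟨isMinError_basisMeas hB (h0 hp hp1) (hsnd h.le), isWeylCovariant_basisMeas _ _⟩
  · refine eq_basisMeas_of_isMinError hB (h0 hp hp1) (hsum p) (fun i hi => ?_) hQ
    fin_cases i
    exacts [absurd rfl hi, show 1 - p < p by linarith]
  · refine eq_basisMeas_of_isMinError hB (h0 hp hp1) (hsum p) (fun i hi => ?_) hQ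
    fin_cases i
    exacts [show p < 1 - p by linarith, absurd rfl hi]
  · exact (isMinError_basisMeas hB (h0 hp hp1) (hfst h.ge)).convexComb
      (isMinError_basisMeas hB (h0 hp hp1) (hsnd h.le)) ht ht1
  · exact ⟨isMinError_basisMeas hB.1 hp hl, isWeylCovariant_basisMeas B l,
      fun hlt Q hQ => eq_basisMeas_of_isMinError hB.1 hp hsum hlt hQ⟩
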